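/- Let $V$ be a finite set and let $G'=(V,F)$ be a chordal graph (every cycle of length at least $4$ has a chord). Let $C_1,\dots,C_l\subseteq V$ be the maximal cliques of $G'$, each listed exactly once, in an order with the running intersection property: for every $r=1,\dots,l-1$ there is $s\ge r+1$ with $U_r\subsetneq C_s$, where $U_r := C_r\cap(C_{r+1}\cup\cdots\cup C_l)$. Let $\bar X$ be a real partial symmetric matrix indexed by $V\times V$ whose specified entries are exactly the diagonal entries and the entries $\bar X_{ij}=\bar X_{ji}$ with $\{i,j\}\in F$, and suppose that the principal submatrix $\bar X_{C_rC_r}$ is positive definite for every $r=1,\dots,l$. A positive definite completion of $\bar X$ is a symmetric positive definite matrix that agrees with $\bar X$ at all specified entries. Then among the positive definite completions of $\bar X$ there is exactly one, $\hat X$, whose determinant is maximal, and $$\ln\det\hat X=\sum_{r=1}^{l}\ln\det\bar X_{C_rC_r}-\sum_{r=1}^{l-1}\ln\det\bar X_{U_rU_r}$$ (the determinant of an empty matrix being $1$). -/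

import Mathlib

namespace MatrixCompletion

/-- A graph is chordal if every cycle of length at least four has a chord, i.e. an edge of the graph
joining two vertices of the cycle that are not consecutive on it. -/
def IsChordal {V : Type*} (G : SimpleGraph V) : Prop :=
  ∀ (v : V) (p : G.Walk v v), p.IsCycle → 4 ≤ p.length →
    ∃ x ∈ p.support, ∃ y ∈ p.support, G.Adj x y ∧ s(x, y) ∉ p.edges

/-- The separator `U r = C r ∩ (C (r+1) ∪ ⋯ ∪ C l)` of a finite sequence of vertex sets
(the last one is empty). -/
def separator {V : Type*} [DecidableEq V] {l : ℕ} (C : Fin l → Finset V) (r : Fin l) : Finset V :=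
  C r ∩ (Finset.Ioi r).biUnion C

/-- `C` lists all maximal cliques of `G`, each exactly once, in an order that has the running
intersection property: every `U r` other than the last is a proper subset of some later `C s`. -/
structure IsRunningIntersectionOrdering {V : Type*} [DecidableEq V] (G : SimpleGraph V) {l : ℕ}
    (C : Fin l → Finset V) : Prop where
  injective : Function.Injective C
  mem_iff : ∀ K : Finset V, (∃ r, C r = K) ↔ Maximal G.IsClique (K : Set V)
  running : ∀ r : Fin l, (r : ℕ) + 1 < l → ∃ s, r < s ∧ separator C r ⊂ C s

theorem IsRunningIntersectionOrdering.isClique {V : Type*} [DecidableEq V] {G : SimpleGraph V}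
    {l : ℕ} {C : Fin l → Finset V} (h : IsRunningIntersectionOrdering G C) (r : Fin l) :
    G.IsClique (C r : Set V) :=
  ((h.mem_iff (C r)).1 ⟨r, rfl⟩).prop

theorem IsRunningIntersectionOrdering.isClique_separator {V : Type*} [DecidableEq V]
    {G : SimpleGraph V} {l : ℕ} {C : Fin l → Finset V} (h : IsRunningIntersectionOrdering G C)
    (r : Fin l) : G.IsClique (separator C r : Set V) :=
  (h.isClique r).subset (Finset.coe_subset.2 Finset.inter_subset_left)

/-- A partial real symmetric matrix with pattern `G`: exactly the diagonal entries and the entries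
at the edges of `G` are specified. -/
structure PartialSymMatrix {V : Type*} (G : SimpleGraph V) where
  entry : ∀ i j : V, i = j ∨ G.Adj i j → ℝ
  symm : ∀ (i j : V) (h : i = j ∨ G.Adj i j) (h' : j = i ∨ G.Adj j i), entry i j h = entry j i h'

namespace PartialSymMatrix

/-- The principal submatrix indexed by a clique; all of its entries are specified. -/
def block {V : Type*} {G : SimpleGraph V} (A : PartialSymMatrix G) (K : Finset V)
    (hK : G.IsClique (K : Set V)) : Matrix K K ℝ :=
  Matrix.of fun i j => A.entry i j
    ((em ((i : V) = j)).imp_right fun hij => hK i.2 j.2 hij)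

/-- `X` is a completion: it agrees with the partial matrix at every specified entry. -/
def IsCompletion {V : Type*} {G : SimpleGraph V} (A : PartialSymMatrix G)
    (X : Matrix V V ℝ) : Prop :=
  ∀ (i j : V) (h : i = j ∨ G.Adj i j), X i j = A.entry i j h

/-- `X` is a (symmetric) positive definite completion. -/
def IsPosDefCompletion {V : Type*} {G : SimpleGraph V} (A : PartialSymMatrix G)
    (X : Matrix V V ℝ) : Prop :=
  A.IsCompletion X ∧ X.PosDef

/-- `X` is a positive definite completion whose determinant is maximal among all of them. -/
def IsMaxDetCompletion {V : Type*} [Fintype V] [DecidableEq V] {G : SimpleGraph V}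
    (A : PartialSymMatrix G) (X : Matrix V V ℝ) : Prop :=
  A.IsPosDefCompletion X ∧ ∀ Y : Matrix V V ℝ, A.IsPosDefCompletion Y → Y.det ≤ X.det

end PartialSymMatrix

end MatrixCompletion

namespace MatrixCompletion

open Matrix

/-! ### Optimality: maximal determinant from an orthogonality condition -/

section Determinant

variable {n : Type*} [Fintype n] [DecidableEq n]

/-! It suffices to find one positive definite completion `X` whose inverse vanishes at every
unspecified position. For any other completion `Y`, the difference `Y - X` vanishes at the specified
positions, so `tr (X⁻¹ (Y - X)) = 0`. Thus `X⁻¹ Y` has trace `n`, and AM-GM for its eigenvalues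
gives `det Y ≤ det X` with equality only for `Y = X` (`det_le_det_of_trace_inv_mul_sub_eq_zero`).

Such an `X` is built by adding the cliques from the last to the first (`exists_partial_completion`).
The running intersection property puts `U r` inside a single later clique, so the block already
constructed and the block of `C r` agree on `U r`. Gaussian elimination of `C r \ U r` against `U r`
glues them (`exists_posDef_gluing`). The inverse changes by `P⁻¹ - N⁻¹`, which off the diagonal is
supported on the clique, and the determinant is multiplied by `det P / det N`; the logarithms of
these ratios add up to the formula. -/

theorem det_le_one_of_posDef_of_trace_eq {M : Matrix n n ℝ} (hM : M.PosDef)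
    (ht : M.trace = Fintype.card n) : M.det ≤ 1 ∧ (M.det = 1 → M = 1) := by
  have hpos := hM.eigenvalues_pos
  have hdet : M.det = ∏ i, hM.1.eigenvalues i := by simpa using hM.1.det_eq_prod_eigenvalues
  have htr : ∑ i, (hM.1.eigenvalues i - 1) = 0 := by
    have := hM.1.trace_eq_sum_eigenvalues
    simp only [RCLike.ofReal_real_eq_id, id_eq] at this
    rw [Finset.sum_sub_distrib, ← this, ht]
    simp
  have hlog : Real.log M.det = ∑ i, Real.log (hM.1.eigenvalues i) := by
    rw [hdet, Real.log_prod fun i _ => (hpos i).ne']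
  -- AM-GM in tangent-line form: the right-hand sides sum to `0` by the trace condition, and
  -- equality of the sums forces every eigenvalue to be `1`.
  have hle : ∀ i ∈ Finset.univ, Real.log (hM.1.eigenvalues i) ≤ hM.1.eigenvalues i - 1 :=
    fun i _ => Real.log_le_sub_one_of_pos (hpos i)
  refine ⟨?_, fun h => ?_⟩
  · rw [← Real.log_nonpos_iff hM.det_pos.le, hlog]
    exact (Finset.sum_le_sum hle).trans_eq htr
  · rw [h, Real.log_one] at hlog
    replace hlog := (Finset.sum_eq_sum_iff_of_le hle).1 (hlog.symm.trans htr.symm)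
    have h1 : hM.1.eigenvalues = 1 := by
      funext i
      by_contra hi
      exact (Real.log_lt_sub_one_of_pos (hpos i) hi).ne (hlog i (Finset.mem_univ i))
    rw [hM.1.spectral_theorem, h1]
    have : diagonal ((RCLike.ofReal : ℝ → ℝ) ∘ (1 : n → ℝ)) = 1 := by ext; simp
    rw [this, map_one]

open scoped MatrixOrder Matrix.Norms.L2Operator in
/-- A positive definite matrix `X` uniquely maximizes the determinant among the positive definite
matrices `Y` for which `Y - X` is orthogonal to `X⁻¹`. -/
theorem det_le_det_of_trace_inv_mul_sub_eq_zero {X Y : Matrix n n ℝ} (hX : X.PosDef)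
    (hY : Y.PosDef) (h : (X⁻¹ * (Y - X)).trace = 0) :
    Y.det ≤ X.det ∧ (Y.det = X.det → Y = X) := by
  have hXu : IsUnit X.det := hX.det_pos.ne'.isUnit
  obtain ⟨B, hB⟩ := CStarAlgebra.nonneg_iff_eq_star_mul_self.mp hX.inv.posSemidef.nonneg
  rw [star_eq_conjTranspose] at hB
  have hBdet : X.det * (B.det * B.det) = 1 := by
    have := congrArg det hB
    rw [det_mul, det_conjTranspose, star_trivial] at this
    rw [← this, ← det_mul, mul_nonsing_inv _ hXu, det_one]
  have hBu : IsUnit B.det := isUnit_of_mul_isUnit_left (isUnit_of_mul_isUnit_right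
    (hBdet ▸ isUnit_one))
  -- With `X⁻¹ = Bᴴ B`, this is a symmetric stand-in for `X⁻¹ Y`, with the same trace and
  -- determinant.
  have hM : (B * Y * Bᴴ).PosDef := by
    refine hY.mul_mul_conjTranspose_same ?_
    exact vecMul_injective_of_isUnit ((isUnit_iff_isUnit_det B).2 hBu)
  have htr : (B * Y * Bᴴ).trace = Fintype.card n := by
    rw [mul_sub, trace_sub, nonsing_inv_mul _ hXu, trace_one, sub_eq_zero] at h
    rw [trace_mul_comm, ← mul_assoc, ← hB, h]
  have hdet : (B * Y * Bᴴ).det * X.det = Y.det := by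
    rw [det_mul, det_mul, det_conjTranspose, star_trivial]
    linear_combination Y.det * hBdet
  obtain ⟨h1, h2⟩ := det_le_one_of_posDef_of_trace_eq hM htr
  refine ⟨?_, fun he => ?_⟩
  · rw [← hdet]
    exact mul_le_of_le_one_left hX.det_pos.le h1
  · have h3 := h2 (mul_right_cancel₀ hX.det_pos.ne' (by rw [hdet, he, one_mul]))
    have h4 : X⁻¹ * Y = 1 := by
      have h5 : B * (Y * Bᴴ) = 1 := by rw [← mul_assoc, h3]
      have h6 := mul_eq_one_comm.1 h5
      rw [hB]
      rw [mul_assoc] at h6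
      exact mul_eq_one_comm.1 h6
    rw [← one_mul Y, ← mul_nonsing_inv _ hXu, mul_assoc, h4, mul_one]

end Determinant

/-! ### Padded blocks and coordinate projections, all of size `V × V` -/

section Padding

variable {V : Type*} [Fintype V] [DecidableEq V]

theorem posDef_fromBlocks_zero_zero {m n : Type*} [Fintype m] [Fintype n] {M : Matrix m m ℝ}
    {N : Matrix n n ℝ} (hM : M.PosDef) (hN : N.PosDef) : (fromBlocks M 0 0 N).PosDef := by
  refine .of_dotProduct_mulVec_pos (hM.1.fromBlocks (by simp) hN.1) fun x hx => ?_
  obtain ⟨a, b, rfl⟩ : ∃ a b, x = Sum.elim a b := ⟨x ∘ Sum.inl, x ∘ Sum.inr, by simp⟩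
  have : star (Sum.elim a b) = Sum.elim (star a) (star b) := by
    ext (i | i) <;> simp
  rw [fromBlocks_mulVec, this, sumElim_dotProduct_sumElim]
  simp only [Sum.elim_comp_inl, Sum.elim_comp_inr, zero_mulVec, add_zero, zero_add]
  by_cases ha : a = 0
  · have hb : b ≠ 0 := by
      rintro rfl
      exact hx (by ext (i | i) <;> simp [ha])
    simpa [ha] using hN.dotProduct_mulVec_pos hb
  · exact add_pos_of_pos_of_nonneg (hM.dotProduct_mulVec_pos ha)
      (hN.posSemidef.dotProduct_mulVec_nonneg b)

/-- The matrix with principal block `M` at `K`, extended by an identity block. -/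
def padBlock (K : Finset V) (M : Matrix K K ℝ) : Matrix V V ℝ :=
  (fromBlocks M 0 0 1).submatrix (Equiv.sumCompl (· ∈ K)).symm (Equiv.sumCompl (· ∈ K)).symm

theorem padBlock_posDef {K : Finset V} {M : Matrix K K ℝ} (hM : M.PosDef) :
    (padBlock K M).PosDef :=
  (posDef_fromBlocks_zero_zero hM .one).submatrix (Equiv.injective _)

theorem det_padBlock (K : Finset V) (M : Matrix K K ℝ) : (padBlock K M).det = M.det := by
  rw [padBlock, det_submatrix_equiv_self, det_fromBlocks_zero₂₁, det_one, mul_one]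

omit [Fintype V] in
theorem padBlock_apply_mem (K : Finset V) (M : Matrix K K ℝ) {i j : V} (hi : i ∈ K) (hj : j ∈ K) :
    padBlock K M i j = M ⟨i, hi⟩ ⟨j, hj⟩ := by
  simp [padBlock, Equiv.sumCompl_symm_apply_of_pos, hi, hj]

omit [Fintype V] in
theorem padBlock_apply_notMem (K : Finset V) (M : Matrix K K ℝ) (i : V) {j : V} (hj : j ∉ K) :
    padBlock K M i j = (1 : Matrix V V ℝ) i j := by
  by_cases hi : i ∈ K
  · have : i ≠ j := fun h => hj (h ▸ hi)
    simp [padBlock, Equiv.sumCompl_symm_apply_of_pos, Equiv.sumCompl_symm_apply_of_neg, hi, hj,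
      this]
  · simp [padBlock, Equiv.sumCompl_symm_apply_of_neg, hi, hj, one_apply]

/-- The diagonal matrix that projects to the coordinates in `K`. -/
def coordProj (K : Finset V) : Matrix V V ℝ :=
  diagonal fun i => if i ∈ K then 1 else 0

omit [Fintype V] in
theorem coordProj_transpose (K : Finset V) : (coordProj K)ᵀ = coordProj K :=
  diagonal_transpose _

theorem coordProj_mul_coordProj (K L : Finset V) :
    coordProj K * coordProj L = coordProj (K ∩ L) := by
  simp [coordProj, ← ite_and, and_comm]

omit [Fintype V] in
theorem coordProj_empty : coordProj (∅ : Finset V) = 0 := by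
  simp [coordProj]

omit [Fintype V] in
theorem coordProj_union {K L : Finset V} (h : Disjoint K L) :
    coordProj (K ∪ L) = coordProj K + coordProj L := by
  rw [coordProj, coordProj, coordProj, diagonal_add]
  congr 1
  funext i
  have hi : i ∈ K → i ∉ L := fun hK => Finset.disjoint_left.1 h hK
  by_cases hK : i ∈ K <;> by_cases hL : i ∈ L <;> simp_all [Finset.mem_union]

theorem coordProj_compl (K : Finset V) : coordProj Kᶜ = 1 - coordProj K := by
  rw [eq_sub_iff_add_eq, ← coordProj_union disjoint_compl_left, ← Finset.sup_eq_union,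
    compl_sup_eq_top]
  simp [coordProj]

theorem coordProj_mul_apply (K : Finset V) (M : Matrix V V ℝ) (i j : V) :
    (coordProj K * M) i j = if i ∈ K then M i j else 0 := by
  simp [coordProj, diagonal_mul]

theorem mul_coordProj_apply (K : Finset V) (M : Matrix V V ℝ) (i j : V) :
    (M * coordProj K) i j = if j ∈ K then M i j else 0 := by
  simp [coordProj, mul_diagonal]

theorem mul_coordProj_eq_iff {K : Finset V} {M N : Matrix V V ℝ} :
    M * coordProj K = N * coordProj K ↔ ∀ i, ∀ j ∈ K, M i j = N i j := by
  simp only [← Matrix.ext_iff, mul_coordProj_apply]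
  refine ⟨fun h i j hj => by simpa [hj] using h i j, fun h i j => ?_⟩
  split_ifs with hj
  exacts [h i j hj, rfl]

theorem coordProj_mul_mul_eq_iff {K : Finset V} {M N : Matrix V V ℝ} :
    coordProj K * M * coordProj K = coordProj K * N * coordProj K ↔
      ∀ i ∈ K, ∀ j ∈ K, M i j = N i j := by
  rw [mul_coordProj_eq_iff]
  simp only [coordProj_mul_apply]
  refine ⟨fun h i hi j hj => by simpa [hi] using h i j hj, fun h i j hj => ?_⟩
  split_ifs with hi
  exacts [h i hi j hj, rfl]

/-- This is the congruence of `diag(M, N)` by the stacked map `x ↦ (Kx, (1 - K)x)`, which is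
injective because its two components sum to `x`. -/
theorem posDef_coordProj_add {M N : Matrix V V ℝ} (hM : M.PosDef) (hN : N.PosDef) (K : Finset V) :
    (coordProj K * M * coordProj K + (1 - coordProj K) * N * (1 - coordProj K)).PosDef := by
  have key := (posDef_fromBlocks_zero_zero hM hN).conjTranspose_mul_mul_same
    (B := fromRows (coordProj K) (1 - coordProj K)) ?_
  · have h1 : (coordProj K)ᴴ = coordProj K := by
      rw [conjTranspose_eq_transpose_of_trivial, coordProj_transpose]
    have h2 : (1 - coordProj K)ᴴ = 1 - coordProj K := by
      rw [conjTranspose_sub, h1, conjTranspose_one]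
    rwa [conjTranspose_fromRows_eq_fromCols_conjTranspose, h1, h2,
      fromCols_mul_fromBlocks, fromCols_mul_fromRows, mul_zero, mul_zero, add_zero, zero_add] at key
  · intro x y hxy
    simp only [fromRows_mulVec] at hxy
    have h1 := (Sum.elim_eq_iff.1 hxy).1
    have h2 := (Sum.elim_eq_iff.1 hxy).2
    have h3 := congrArg₂ (· + ·) h1 h2
    simpa [← add_mulVec] using h3

end Padding

/-! ### Gluing two positive definite matrices along a common block -/

section Gluing

variable {V : Type*} [Fintype V] [DecidableEq V]

/-- Gluing step. `P` is the identity outside the coordinates of `e + f`, `N` is the identity outside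
those of `f`, `X` is the identity on those of `e`, and all three agree on the block of `f`. The
matrix `Y` agrees with `P` on the block of `e + f`, with `X` off the coordinates of `e`, and
`Y⁻¹ = P⁻¹ + X⁻¹ - N⁻¹`. -/
theorem exists_posDef_gluing {R U : Finset V} (hRU : Disjoint R U) {P N X : Matrix V V ℝ}
    (hP : P.PosDef) (hN : N.PosDef) (hX : X.PosDef)
    (hPc : P * coordProj (R ∪ U)ᶜ = coordProj (R ∪ U)ᶜ)
    (hNc : N * coordProj Uᶜ = coordProj Uᶜ) (hXe : X * coordProj R = coordProj R)
    (hPN : coordProj U * P * coordProj U = coordProj U * N * coordProj U)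
    (hXN : coordProj U * X * coordProj U = coordProj U * N * coordProj U) :
    ∃ Y : Matrix V V ℝ, Y.PosDef ∧
      coordProj (R ∪ U) * Y * coordProj (R ∪ U) = coordProj (R ∪ U) * P * coordProj (R ∪ U) ∧
      coordProj Rᶜ * Y * coordProj Rᶜ = coordProj Rᶜ * X * coordProj Rᶜ ∧
      (∀ L : Finset V, P * coordProj L = coordProj L → N * coordProj L = coordProj L →
        X * coordProj L = coordProj L → Y * coordProj L = coordProj L) ∧
      Y⁻¹ = P⁻¹ + X⁻¹ - N⁻¹ ∧ Y.det * N.det = P.det * X.det := by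
  rw [coordProj_compl, coordProj_union hRU] at hPc
  rw [coordProj_compl] at hNc
  rw [coordProj_compl, coordProj_union hRU]
  have hef : coordProj R * coordProj U = 0 := by
    rw [coordProj_mul_coordProj, Finset.disjoint_iff_inter_eq_empty.1 hRU, coordProj_empty]
  have hfe : coordProj U * coordProj R = 0 := by
    rw [coordProj_mul_coordProj, Finset.disjoint_iff_inter_eq_empty.1 hRU.symm, coordProj_empty]
  have hee : coordProj R * coordProj R = coordProj R := by
    rw [coordProj_mul_coordProj, Finset.inter_self]
  have hff : coordProj U * coordProj U = coordProj U := by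
    rw [coordProj_mul_coordProj, Finset.inter_self]
  have het := coordProj_transpose R
  have hft := coordProj_transpose U
  have hPD : ∀ {M N : Matrix V V ℝ}, M.PosDef → N.PosDef → (coordProj R * M * coordProj R +
    (1 - coordProj R) * N * (1 - coordProj R)).PosDef := fun hM hN => posDef_coordProj_add hM hN R
  have hLe : ∀ L, coordProj L * coordProj R = coordProj R * coordProj L := fun L => by
    rw [coordProj_mul_coordProj, coordProj_mul_coordProj, Finset.inter_comm]
  have hLt := coordProj_transpose (V := V)
  -- From here on, the argument is noncommutative algebra with the orthogonal symmetric idempotents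
  -- `e` and `f`.
  generalize coordProj R = e at *
  generalize coordProj U = f at *
  have hPt : Pᵀ = P := by simpa using hP.1.eq
  have hNt : Nᵀ = N := by simpa using hN.1.eq
  have hXt : Xᵀ = X := by simpa using hX.1.eq
  have hPu := hP.det_pos.ne'.isUnit
  have hNu := hN.det_pos.ne'.isUnit
  have hXu := hX.det_pos.ne'.isUnit
  have eX : e * X = e := by simpa [hXt, het] using congrArg transpose hXe
  have Nf : N * f = N - 1 + f := by
    rw [mul_sub, mul_one] at hNc; linear_combination (norm := abel) -hNc
  have fN : f * N = N - 1 + f := by simpa [hNt, hft] using congrArg transpose Nf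
  have Ne : N * e = e := by
    have := congrArg (· * e) Nf
    simp only [mul_assoc, hfe, add_mul, sub_mul, one_mul, mul_zero, add_zero] at this
    exact sub_eq_zero.1 this.symm
  have eN : e * N = e := by simpa [hNt, het] using congrArg transpose Ne
  have fNf : f * N * f = N - 1 + f := by
    rw [mul_assoc, Nf, mul_add, mul_sub, fN, hff]; noncomm_ring
  have Pf : P * f = P - 1 + e + f - P * e := by
    rw [mul_sub, mul_one, mul_add] at hPc; linear_combination (norm := abel) -hPc
  have eNi : e * N⁻¹ = e := by rw [← eN, mul_assoc, mul_nonsing_inv _ hNu, mul_one, eN]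
  have Nie : N⁻¹ * e = e := by
    conv_lhs => rw [← Ne, ← mul_assoc, nonsing_inv_mul _ hNu, one_mul]
  have eXi : e * X⁻¹ = e := by
    conv_lhs => rw [← eX, mul_assoc, mul_nonsing_inv _ hXu, mul_one]
  have Nif : N⁻¹ * f = f * N⁻¹ := by
    have h1 : N * f = f * N := by rw [Nf, fN]
    calc N⁻¹ * f = N⁻¹ * (f * N) * N⁻¹ := by
          rw [mul_assoc, mul_assoc, mul_nonsing_inv _ hNu, mul_one]
      _ = f * N⁻¹ := by rw [← h1, ← mul_assoc, nonsing_inv_mul _ hNu, one_mul]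
  -- In blocks, `Q` is the elimination multiplier `P_RU P_UU⁻¹`; it is nilpotent, so `1 + Q` and `1
  -- - Q` are mutually inverse.
  obtain ⟨Q, hQ⟩ : ∃ Q, Q = e * P * f * N⁻¹ := ⟨_, rfl⟩
  have eQ : e * Q = Q := by rw [hQ]; simp only [← mul_assoc, hee]
  have Qf : Q * f = Q := by
    rw [hQ, mul_assoc, Nif]; simp only [← mul_assoc]; rw [mul_assoc _ f f, hff]
  have Qe : Q * e = 0 := by rw [← Qf, mul_assoc, hfe, mul_zero]
  have fQ : f * Q = 0 := by rw [← eQ, ← mul_assoc, hfe, zero_mul]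
  have QN : Q * N = e * P * f := by rw [hQ, mul_assoc, nonsing_inv_mul _ hNu, mul_one]
  have QQ : Q * Q = 0 := by rw [← eQ, ← mul_assoc, eQ, Qe, zero_mul]
  have Pe : e * P = e * P * e + e * P * f := by
    rw [mul_assoc _ P f, Pf]
    simp only [mul_add, mul_sub, hee, hef, mul_one, ← mul_assoc]; abel
  have fP : f * P = P - 1 + e + f - e * P := by
    simpa [hPt, hft, het] using congrArg transpose Pf
  have PfN : P - e * P - P * e + e * P * e = N - e := by
    have h1 := fNf
    rw [← hPN, mul_assoc, Pf] at h1
    simp only [mul_add, mul_sub, mul_one, ← mul_assoc, hff, hfe, fP, add_mul, sub_mul, one_mul,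
      hee] at h1
    linear_combination (norm := abel) h1
  have QP : Q * P = Q * P * e + e * P * f := by
    have h1 : Q * P * f = e * P * f := by
      rw [← Qf, mul_assoc Q, mul_assoc Q, hPN, mul_assoc f, ← mul_assoc Q, Qf, ← mul_assoc, QN,
        mul_assoc, hff]
    have h2 : Q * (P * f) = Q * P - Q + Q - Q * P * e := by
      rw [Pf]
      simp only [mul_add, mul_sub, mul_one, ← mul_assoc, Qe, Qf]; abel
    rw [← mul_assoc, h1] at h2
    rw [h2]; abel
  -- The Schur complement `P_RR - P_RU P_UU⁻¹ P_UR`, placed at the block of `R`.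
  obtain ⟨S, hS⟩ : ∃ S, S = e * P - Q * P := ⟨_, rfl⟩
  have hS' : S = e * P * e - Q * P * e := by rw [hS]; linear_combination (norm := abel) Pe - QP
  have eS : e * S = S := by rw [hS, mul_sub, ← mul_assoc, ← mul_assoc, hee, eQ]
  have Se : S * e = S := by
    rw [hS', sub_mul, mul_assoc _ e e, mul_assoc _ e e, hee]
  have eQt : Qᵀ * e = Qᵀ := by simpa [het] using congrArg transpose eQ
  have Qet : e * Qᵀ = 0 := by simpa [het] using congrArg transpose Qe
  have fQt : Qᵀ * f = 0 := by simpa [hft] using congrArg transpose fQ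
  have Qft : f * Qᵀ = Qᵀ := by simpa [hft] using congrArg transpose Qf
  have SQt : S * Qᵀ = 0 := by rw [← Se, mul_assoc, Qet, mul_zero]
  have hSt : Sᵀ = S := by
    have h1 : S = (e - Q) * P * (e - Qᵀ) := by
      rw [sub_mul, ← hS, mul_sub, Se, SQt, sub_zero]
    rw [h1]
    simp [hPt, het, mul_assoc]
  have PQt : P * Qᵀ = P * e - S := by
    have h1 : Q * P = e * P - S := by rw [hS]; abel
    simpa [hPt, het, hSt] using congrArg transpose h1
  -- Block elimination decouples `R`: subtracting `e` removes the identity that `N` has there,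
  -- leaving room for `S`.
  have hB : (1 - Q) * P * (1 - Qᵀ) = S + N - e := by
    have h1 : (1 - Q) * P = P - e * P + S := by rw [hS]; noncomm_ring
    rw [h1, mul_sub, mul_one, add_mul, SQt, sub_mul, mul_assoc, PQt, mul_sub, eS, ← mul_assoc]
    linear_combination (norm := abel) PfN
  have hL : (1 - Q) * (1 + Q) = 1 := by
    rw [sub_mul, mul_add, mul_add, QQ]; noncomm_ring
  have hL' : (1 + Q) * (1 - Q) = 1 := mul_eq_one_comm.1 hL
  have hLt' : (1 - Qᵀ) * (1 + Qᵀ) = 1 := by simpa using congrArg transpose hL'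
  have hP' : P = (1 + Q) * (S + N - e) * (1 + Qᵀ) := by
    rw [← hB]
    calc P = ((1 + Q) * (1 - Q)) * P * ((1 - Qᵀ) * (1 + Qᵀ)) := by rw [hL', hLt']; simp
      _ = _ := by simp only [mul_assoc]
  have hBP : (S + N - e).PosDef := by
    have h1 : (1 - Qᵀ) = (1 - Q)ᴴ := by simp
    rw [← hB, h1]
    exact hP.mul_mul_conjTranspose_same
      (vecMul_injective_of_isUnit (IsUnit.of_mul_eq_one _ hL))
  have hWP : (S + X - e).PosDef := by
    convert hPD hBP hX using 1
    simp only [mul_add, mul_sub, add_mul, sub_mul, eS, Se, eN, hee, eX, hXe, one_mul, mul_one]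
    abel
  have hD : e * (X - N) = 0 := by rw [mul_sub, eX, eN, sub_self]
  have hD' : (X - N) * e = 0 := by rw [sub_mul, hXe, Ne, sub_self]
  -- The witness is the factorization `hP'` of `P` with `N` replaced by `X`. The correction `X - N`
  -- is killed by `e` on both sides and vanishes on the block of `U`.
  have hY : (1 + Q) * (S + X - e) * (1 + Qᵀ) = P + (1 + Q) * (X - N) * (1 + Qᵀ) := by
    conv_rhs => rw [hP']
    rw [← add_mul, ← mul_add]
    congr 2; abel
  refine ⟨(1 + Q) * (S + X - e) * (1 + Qᵀ), ?_, ?_, ?_, ?_, ?_, ?_⟩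
  · have h1 : (1 + Qᵀ) = (1 + Q)ᴴ := by simp
    rw [h1]
    exact hWP.mul_mul_conjTranspose_same
      (vecMul_injective_of_isUnit (IsUnit.of_mul_eq_one _ hL'))
  · have h1 : (e + f) * (1 + Q) * (X - N) = (1 + Q) * (f * (X - N)) := by
      have : (e + f) * (1 + Q) = e + (1 + Q) * f := by
        simp only [mul_add, add_mul, eQ, fQ, Qf, mul_one, one_mul, add_zero]; abel
      rw [this, add_mul, hD, zero_add, mul_assoc]
    have h2 : (1 + Qᵀ) * (e + f) = e + f * (1 + Qᵀ) := by
      simp only [mul_add, add_mul, eQt, fQt, Qft, mul_one, one_mul, add_zero]; abel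
    have h3 : f * (X - N) * f = 0 := by rw [mul_sub, sub_mul, hXN, sub_self]
    have h4 : (e + f) * ((1 + Q) * (X - N) * (1 + Qᵀ)) * (e + f) = 0 := by
      calc (e + f) * ((1 + Q) * (X - N) * (1 + Qᵀ)) * (e + f)
          = (e + f) * (1 + Q) * (X - N) * ((1 + Qᵀ) * (e + f)) := by simp only [mul_assoc]
        _ = (1 + Q) * (f * ((X - N) * e)) + (1 + Q) * (f * (X - N) * f) * (1 + Qᵀ) := by
          rw [h1, h2, mul_add ((1 + Q) * _)]; simp only [mul_assoc]
        _ = 0 := by rw [hD', h3]; simp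
    rw [hY, mul_add (e + f), add_mul _ _ (e + f), h4, add_zero]
  · have h1 : (1 - e) * (1 + Q) = 1 - e := by rw [mul_add, sub_mul _ _ Q, eQ]; simp
    have h2 : (1 + Qᵀ) * (1 - e) = 1 - e := by rw [add_mul, mul_sub Qᵀ, eQt]; simp
    rw [← mul_assoc, ← mul_assoc, h1, mul_assoc _ (1 + Qᵀ), h2]
    simp only [mul_add, mul_sub, add_mul, sub_mul, eS, Se, hee, eX, hXe, one_mul, mul_one]
    abel
  · intro L hPL hNL hXL
    have hLe := hLe L
    have hLt := hLt L
    generalize coordProj L = g at *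
    have gP : g * P = g := by simpa [hPt, hLt] using congrArg transpose hPL
    have gQ : g * Q = 0 := by
      rw [hQ, ← mul_assoc, ← mul_assoc, ← mul_assoc, hLe, mul_assoc e, gP, ← hLe, mul_assoc g, hef]
      simp
    have Qg : Qᵀ * g = 0 := by simpa [hLt] using congrArg transpose gQ
    have hg : (1 + Qᵀ) * g = g := by rw [add_mul, Qg, add_zero, one_mul]
    rw [hY, add_mul, hPL, mul_assoc _ _ g, hg, mul_assoc, sub_mul,
      hXL, hNL, sub_self, mul_zero, add_zero]
  · refine inv_eq_right_inv ?_
    have eT : e * (X⁻¹ - N⁻¹) = 0 := by rw [mul_sub, eXi, eNi, sub_self]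
    have QT : (1 + Qᵀ) * (X⁻¹ - N⁻¹) = X⁻¹ - N⁻¹ := by
      rw [add_mul, ← eQt, mul_assoc, eT, mul_zero, add_zero, one_mul]
    have ST : S * (X⁻¹ - N⁻¹) = 0 := by rw [← Se, mul_assoc, eT, mul_zero]
    have PT : P * (X⁻¹ - N⁻¹) = (1 + Q) * (N * (X⁻¹ - N⁻¹)) := by
      conv_lhs => rw [hP']
      rw [mul_assoc, QT, mul_assoc, sub_mul (S + N), add_mul S, ST,
        eT, zero_add, sub_zero]
    have h1 : (X - N) * N⁻¹ * (S + N - e) = X - N := by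
      have h2 : N⁻¹ * S = S := by rw [← eS, ← mul_assoc, Nie]
      have h3 : (X - N) * S = 0 := by rw [← eS, ← mul_assoc, hD', zero_mul]
      rw [mul_assoc, mul_sub N⁻¹, mul_add N⁻¹, h2, nonsing_inv_mul _ hNu, Nie, mul_sub, mul_add,
        h3, hD', zero_add, mul_one, sub_zero]
    have h2 : (X - N) * N⁻¹ * Q = 0 := by
      rw [← eQ, ← mul_assoc, mul_assoc _ N⁻¹ e, Nie, hD', zero_mul]
    have h3 : (X - N) * (1 + Qᵀ) * P⁻¹ = (X - N) * N⁻¹ := by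
      have : (X - N) * N⁻¹ * P = (X - N) * (1 + Qᵀ) := by
        conv_lhs => rw [hP']
        rw [← mul_assoc, ← mul_assoc, mul_add _ 1 Q, h2, mul_one, add_zero, h1]
      rw [← this, mul_assoc, mul_nonsing_inv _ hPu, mul_one]
    have h4 : N * (X⁻¹ - N⁻¹) + (X - N) * N⁻¹ + (X - N) * (X⁻¹ - N⁻¹) = 0 := by
      simp only [mul_sub, sub_mul, mul_nonsing_inv _ hNu, mul_nonsing_inv _ hXu]; abel
    calc (1 + Q) * (S + X - e) * (1 + Qᵀ) * (P⁻¹ + X⁻¹ - N⁻¹)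
        = P * P⁻¹ + P * (X⁻¹ - N⁻¹) + (1 + Q) * ((X - N) * (1 + Qᵀ) * P⁻¹) +
          (1 + Q) * ((X - N) * ((1 + Qᵀ) * (X⁻¹ - N⁻¹))) := by
          rw [hY, add_sub_assoc, mul_add _ P⁻¹, add_mul P, add_mul P]
          simp only [mul_assoc]; abel
      _ = 1 + (1 + Q) * (N * (X⁻¹ - N⁻¹) + (X - N) * N⁻¹ + (X - N) * (X⁻¹ - N⁻¹)) := by
          rw [PT, h3, QT, mul_nonsing_inv _ hPu, mul_add (1 + Q), mul_add (1 + Q)]; abel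
      _ = 1 := by rw [h4, mul_zero, add_zero]
  -- Both `S` and `e` absorb `X` and `N` on the right, so `det Y` and `det P` share all factors
  -- except `det X` and `det N`.
  · have h1 : S + X - e = (S + 1 - e) * X := by
      have : S * X = S := by rw [← Se, mul_assoc, eX]
      rw [sub_mul, add_mul, this, eX, one_mul]
    have h2 : S + N - e = (S + 1 - e) * N := by
      have : S * N = S := by rw [← Se, mul_assoc, eN]
      rw [sub_mul, add_mul, this, eN, one_mul]
    rw [h1]
    conv_rhs => rw [hP', h2]
    simp only [det_mul]
    ring
end Gluing

/-! ### Building the completion clique by clique -/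

section Completion

variable {V : Type*} [Fintype V] [DecidableEq V]

theorem padBlock_inv {K : Finset V} {M : Matrix K K ℝ} (hM : M.PosDef) :
    (padBlock K M)⁻¹ = padBlock K M⁻¹ := by
  refine inv_eq_right_inv ?_
  rw [padBlock, padBlock, submatrix_mul_equiv, fromBlocks_multiply]
  simp [mul_nonsing_inv _ hM.det_pos.ne'.isUnit]

omit [Fintype V] in
theorem padBlock_apply_notMem_left (K : Finset V) (M : Matrix K K ℝ) {i : V} (hi : i ∉ K) (j : V) :
    padBlock K M i j = (1 : Matrix V V ℝ) i j := by
  by_cases hj : j ∈ K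
  · have : i ≠ j := fun h => hi (h ▸ hj)
    simp [padBlock, Equiv.sumCompl_symm_apply_of_pos, Equiv.sumCompl_symm_apply_of_neg, hi, hj,
      this]
  · exact padBlock_apply_notMem K M i hj

theorem padBlock_inv_apply_eq_zero {K : Finset V} {M : Matrix K K ℝ} (hM : M.PosDef) {i j : V}
    (hij : i ≠ j) (h : ¬(i ∈ K ∧ j ∈ K)) : (padBlock K M)⁻¹ i j = 0 := by
  rw [padBlock_inv hM]
  by_cases hi : i ∈ K
  · rw [padBlock_apply_notMem _ _ _ fun hj => h ⟨hi, hj⟩, one_apply_ne hij]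
  · rw [padBlock_apply_notMem_left _ _ hi, one_apply_ne hij]

theorem padBlock_mul_coordProj {K L : Finset V} (M : Matrix K K ℝ) (h : Disjoint K L) :
    padBlock K M * coordProj L = coordProj L := by
  rw [← one_mul (coordProj L), ← mul_assoc, mul_one, mul_coordProj_eq_iff]
  exact fun i j hj => padBlock_apply_notMem K M i (Finset.disjoint_right.1 h hj)

variable {G : SimpleGraph V}

omit [Fintype V] [DecidableEq V] in
theorem PartialSymMatrix.block_posDef_of_subset (A : PartialSymMatrix G) {K L : Finset V}
    (hK : G.IsClique (K : Set V)) (hL : G.IsClique (L : Set V)) (h : L ⊆ K)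
    (hA : (A.block K hK).PosDef) : (A.block L hL).PosDef :=
  hA.submatrix (Set.inclusion_injective h)

omit [Fintype V] in
theorem mem_separator {l : ℕ} {C : Fin l → Finset V} {r : Fin l} {i : V} :
    i ∈ separator C r ↔ i ∈ C r ∧ ∃ s, r < s ∧ i ∈ C s := by
  simp [separator]

/-- Gluing the cliques `C s` for `s ≥ k` one after the other, from the last one downwards. -/
theorem exists_partial_completion {l : ℕ} {C : Fin l → Finset V}
    (hC : IsRunningIntersectionOrdering G C) (A : PartialSymMatrix G)
    (hA : ∀ r, (A.block (C r) (hC.isClique r)).PosDef) (n k : ℕ) (hk : k + n = l) :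
    ∃ X : Matrix V V ℝ, X.PosDef ∧
      (∀ s : Fin l, k ≤ s → ∀ i ∈ C s, ∀ j ∈ C s, ∀ h, X i j = A.entry i j h) ∧
      (∀ j, (∀ s : Fin l, k ≤ s → j ∉ C s) → ∀ i, X i j = (1 : Matrix V V ℝ) i j) ∧
      (∀ i j, i ≠ j → (∀ s : Fin l, k ≤ s → ¬(i ∈ C s ∧ j ∈ C s)) → X⁻¹ i j = 0) ∧
      Real.log X.det = ∑ s : Fin l with k ≤ s.val,
        (Real.log (A.block (C s) (hC.isClique s)).det -
          Real.log (A.block (separator C s) (hC.isClique_separator s)).det) := by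
  induction n generalizing k with
  | zero =>
    have hlt : ∀ s : Fin l, ¬k ≤ s := fun s => by have := s.2; omega
    refine ⟨1, .one, fun s hs => (hlt s hs).elim, fun _ _ _ => rfl, fun i j hij _ => ?_, ?_⟩
    · rw [inv_one, one_apply_ne hij]
    · rw [det_one, Real.log_one, Finset.filter_false_of_mem fun s _ => hlt s, Finset.sum_empty]
  | succ n ih =>
    obtain ⟨X, hX, hXA, hX1, hXi, hXd⟩ := ih (k + 1) (by omega)
    obtain ⟨r, hr⟩ : ∃ r : Fin l, (r : ℕ) = k := ⟨⟨k, by omega⟩, rfl⟩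
    have hsub : separator C r ⊆ C r := Finset.inter_subset_left
    have hU := A.block_posDef_of_subset (hC.isClique r) (hC.isClique_separator r) hsub (hA r)
    have hRU : C r \ separator C r ∪ separator C r = C r := Finset.sdiff_union_of_subset hsub
    have hge : ∀ s : Fin l, k ≤ s ↔ s = r ∨ k + 1 ≤ s := fun s => by rw [Fin.ext_iff]; omega
    -- The vertices new at this stage lie in no later clique, so `X` is still the identity on them,
    -- as the gluing requires.
    have hRs : ∀ i ∈ C r \ separator C r, ∀ s : Fin l, k + 1 ≤ s → i ∉ C s := by
      intro i hi s hs his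
      rw [Finset.mem_sdiff, mem_separator] at hi
      exact hi.2 ⟨hi.1, s, by rw [Fin.lt_def]; omega, his⟩
    obtain ⟨Y, hY, hYC, hYR, hYL, hYi, hYd⟩ := exists_posDef_gluing
      (R := C r \ separator C r) (U := separator C r)
      (P := padBlock (C r) (A.block (C r) (hC.isClique r)))
      (N := padBlock (separator C r) (A.block (separator C r) (hC.isClique_separator r)))
      Finset.sdiff_disjoint (padBlock_posDef (hA r)) (padBlock_posDef hU) hX
      (by rw [hRU]; exact padBlock_mul_coordProj _ disjoint_compl_right)
      (padBlock_mul_coordProj _ disjoint_compl_right)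
      (by
        rw [← one_mul (coordProj (C r \ _)), ← mul_assoc, mul_one, mul_coordProj_eq_iff]
        exact fun i j hj => hX1 j (hRs j hj) i)
      (by
        rw [coordProj_mul_mul_eq_iff]
        intro i hi j hj
        rw [padBlock_apply_mem _ _ hi hj, padBlock_apply_mem _ _ (hsub hi) (hsub hj)]
        rfl)
      (by
        rw [coordProj_mul_mul_eq_iff]
        intro i hi j hj
        -- A vertex of `U r` shows that `r` is not the last index, so the running intersection
        -- property applies; for empty `U r` there is nothing to check.
        obtain ⟨-, t, hrt, -⟩ := mem_separator.1 hi
        obtain ⟨s, hrs, hs⟩ := hC.running r (by rw [Fin.lt_def] at hrt; omega)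
        rw [padBlock_apply_mem _ _ hi hj]
        exact hXA s (by rw [Fin.lt_def] at hrs; omega) i (hs.subset hi) j (hs.subset hj) _)
    rw [hRU, coordProj_mul_mul_eq_iff] at hYC
    rw [coordProj_mul_mul_eq_iff] at hYR
    refine ⟨Y, hY, fun s hs i hi j hj h => ?_, fun j hj i => ?_, fun i j hij h => ?_, ?_⟩
    · obtain rfl | hs := (hge s).1 hs
      · rw [hYC i hi j hj, padBlock_apply_mem _ _ hi hj]
        rfl
      · rw [hYR i (Finset.mem_compl.2 fun h => hRs i h s hs hi) j
          (Finset.mem_compl.2 fun h => hRs j h s hs hj)]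
        exact hXA s hs i hi j hj h
    · have hjr := hj r hr.ge
      have hj1 := mul_coordProj_eq_iff (K := {j}) (M := Y) (N := 1)
      rw [one_mul] at hj1
      refine hj1.1 (hYL {j} ?_ ?_ ?_) i j (Finset.mem_singleton_self j)
      · exact padBlock_mul_coordProj _ (Finset.disjoint_singleton_right.2 hjr)
      · exact padBlock_mul_coordProj _ (Finset.disjoint_singleton_right.2 fun h => hjr (hsub h))
      · rw [← one_mul (coordProj {j}), ← mul_assoc, mul_one, mul_coordProj_eq_iff]
        intro i j' hj'
        rw [Finset.mem_singleton.1 hj']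
        exact hX1 j (fun s hs => hj s (by omega)) i
    · have hr' := h r hr.ge
      rw [hYi, Matrix.sub_apply, Matrix.add_apply, padBlock_inv_apply_eq_zero (hA r) hij hr',
        padBlock_inv_apply_eq_zero hU hij fun hi => hr' ⟨hsub hi.1, hsub hi.2⟩,
        hXi i j hij fun s hs => h s (by omega)]
      simp
    · have hfil : (Finset.univ.filter fun s : Fin l => k ≤ s.val) =
          insert r (Finset.univ.filter fun s : Fin l => k + 1 ≤ s.val) := by
        ext s
        simp [hge s]
      have h1 := congrArg Real.log hYd
      rw [det_padBlock, det_padBlock, Real.log_mul hY.det_pos.ne' hU.det_pos.ne',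
        Real.log_mul (hA r).det_pos.ne' hX.det_pos.ne', hXd] at h1
      rw [hfil, Finset.sum_insert (by simp [hr])]
      linear_combination h1

/-- By finiteness, the clique `{i, j}` extends to a maximal one, which is listed. -/
theorem IsRunningIntersectionOrdering.exists_mem_mem {l : ℕ} {C : Fin l → Finset V}
    (hC : IsRunningIntersectionOrdering G C) {i j : V} (h : i = j ∨ G.Adj i j) :
    ∃ s, i ∈ C s ∧ j ∈ C s := by
  have hcl : G.IsClique ({i, j} : Set V) := by
    rw [SimpleGraph.isClique_pair]
    exact fun hij => h.resolve_left hij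
  obtain ⟨K, hK, hmax⟩ := (Set.toFinite {s : Set V | G.IsClique s}).exists_le_maximal hcl
  obtain ⟨s, hs⟩ := (hC.mem_iff K.toFinite.toFinset).2 (by simpa using hmax)
  refine ⟨s, ?_, ?_⟩ <;> rw [hs, Set.Finite.mem_toFinset] <;> exact hK (by simp)

theorem exists_posDefCompletion_inv_apply_eq_zero {l : ℕ} {C : Fin l → Finset V}
    (hC : IsRunningIntersectionOrdering G C) (A : PartialSymMatrix G)
    (hA : ∀ r, (A.block (C r) (hC.isClique r)).PosDef) :
    ∃ X : Matrix V V ℝ, A.IsPosDefCompletion X ∧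
      (∀ i j, ¬(i = j ∨ G.Adj i j) → X⁻¹ i j = 0) ∧
      Real.log X.det = (∑ r : Fin l, Real.log (A.block (C r) (hC.isClique r)).det) -
        (∑ r ∈ Finset.univ.filter (fun r : Fin l => r.val + 1 < l),
          Real.log (A.block (separator C r) (hC.isClique_separator r)).det) := by
  obtain ⟨X, hX, hXA, -, hXi, hXd⟩ := exists_partial_completion hC A hA l 0 (zero_add l)
  refine ⟨X, ⟨fun i j h => ?_, hX⟩, fun i j h => ?_, ?_⟩
  · obtain ⟨s, hi, hj⟩ := hC.exists_mem_mem h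
    exact hXA s (Nat.zero_le _) i hi j hj h
  · rw [not_or] at h
    exact hXi i j h.1 fun s _ hs => h.2 (hC.isClique s hs.1 hs.2 h.1)
  · rw [hXd, Finset.filter_true_of_mem fun _ _ => Nat.zero_le _, Finset.sum_sub_distrib,
      Finset.sum_filter_of_ne]
    intro r _ hr
    by_contra hlast
    refine hr ?_
    -- The recursion also counts the last separator; it is empty and contributes `log 1 = 0`.
    have : IsEmpty (separator C r) := by
      refine ⟨fun x => ?_⟩
      obtain ⟨-, s, hrs, -⟩ := mem_separator.1 x.2
      rw [Fin.lt_def] at hrs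
      omega
    rw [det_isEmpty, Real.log_one]

/-- Every product in the trace has a zero factor: `K` off the pattern, `Y - X` on it. -/
theorem PartialSymMatrix.trace_mul_sub_eq_zero {A : PartialSymMatrix G} {K X Y : Matrix V V ℝ}
    (hK : ∀ i j, ¬(i = j ∨ G.Adj i j) → K i j = 0) (hX : A.IsCompletion X)
    (hY : A.IsCompletion Y) : (K * (Y - X)).trace = 0 := by
  simp only [trace, diag_apply, mul_apply, Matrix.sub_apply]
  refine Finset.sum_eq_zero fun i _ => Finset.sum_eq_zero fun j _ => ?_
  by_cases h : i = j ∨ G.Adj i j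
  · have h' : j = i ∨ G.Adj j i := h.imp Eq.symm G.adj_symm
    rw [hX j i h', hY j i h', sub_self, mul_zero]
  · rw [hK i j h, zero_mul]

end Completion

end MatrixCompletion

theorem mainTheorem1 {V : Type*} [Fintype V] [DecidableEq V] (G : SimpleGraph V)
    (hG : MatrixCompletion.IsChordal G)
    {l : ℕ} (C : Fin l → Finset V)
    (hC : MatrixCompletion.IsRunningIntersectionOrdering G C)
    (A : MatrixCompletion.PartialSymMatrix G)
    (hA : ∀ r : Fin l, (A.block (C r) (hC.isClique r)).PosDef) :
    (∃! X : Matrix V V ℝ, A.IsMaxDetCompletion X) ∧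
    ∀ X : Matrix V V ℝ, A.IsMaxDetCompletion X →
      Real.log X.det =
        (∑ r : Fin l, Real.log (A.block (C r) (hC.isClique r)).det) -
        (∑ r ∈ Finset.univ.filter (fun r : Fin l => r.val + 1 < l),
          Real.log (A.block (MatrixCompletion.separator C r) (hC.isClique_separator r)).det) := by
  obtain ⟨X, hX, hXi, hXd⟩ :=
    MatrixCompletion.exists_posDefCompletion_inv_apply_eq_zero hC A hA
  have key : ∀ Y, A.IsPosDefCompletion Y → Y.det ≤ X.det ∧ (Y.det = X.det → Y = X) :=
    fun Y hY => MatrixCompletion.det_le_det_of_trace_inv_mul_sub_eq_zero hX.2 hY.2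
      (MatrixCompletion.PartialSymMatrix.trace_mul_sub_eq_zero hXi hX.1 hY.1)
  have hmax : A.IsMaxDetCompletion X := ⟨hX, fun Y hY => (key Y hY).1⟩
  have huniq : ∀ Y, A.IsMaxDetCompletion Y → Y = X := fun Y hY =>
    (key Y hY.1).2 (le_antisymm (key Y hY.1).1 (hY.2 X hX))
  refine ⟨⟨X, hmax, huniq⟩, fun Y hY => ?_⟩
  rw [huniq Y hY, hXd]
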